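/- **Theorem ($\alpha$-list decoding capacity).** *Definitions.* Let $F$ be a finite field and $l\ge 1$. An $(n,k,l)$ array code over $F$ is a set $\mathcal C\subseteq (F^l)^n$ with $|\mathcal C|=|F|^{kl}$; its codewords are $C=(C_1,\dots,C_n)$ with coordinates $C_i\in F^l$, and the weight $w(E)$ of an error $E\in(F^l)^n$ is the number of $i$ with $E_i\ne 0$. For $\alpha>0$ we say that $\mathcal C$ corrects up to $t$ errors under list-of-$L$ decoding by downloading $\alpha nl$ symbols of $F$ if there are integers $a_1,\dots,a_n\ge 0$ with $\sum_i a_i\le \alpha nl$ and functions $f_i:F^l\to F^{a_i}$ $(1\le i\le n)$ and $g_s:F^{a_1+\dots+a_n}\to (F^l)^n$ $(1\le s\le L)$ such that for every $C\in\mathcal C$ and every error $E$ with $w(E)\le t$ the list $\{g_s(f_1(C_1+E_1),\dots,f_n(C_n+E_n))\}_{s=1}^L$ contains $C$. Let $r_{\alpha,L}(\mathcal C)$ be the largest such $t\le n$, and let $r_{\alpha,L}(n,k)$ be the maximum of $r_{\alpha,L}(\mathcal C)$ over all $(n,k,l)$ array codes over all finite fields and all $l\ge1$. The $\alpha$-list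 decoding capacity of codes of rate $R$ is $$\rho_\alpha(R)=\sup_{m\in\mathbb N}\ \limsup_{n\to\infty}\frac{r_{\alpha,n^m}(n,\lfloor Rn\rfloor)}{n}.$$ For a finite field $F$ with $|F|>nl$ and a primitive element $\gamma$ of $F$, the folded Reed–Solomon code $\mathrm{FRS}(n,k,l)$ consists of all $(C_1,\dots,C_n)$ with $C_i=(h(\gamma^{(i-1)l}),h(\gamma^{(i-1)l+1}),\dots,h(\gamma^{il-1}))$, where $h\in F[x]$, $\deg h<kl$. *Statement.* Let $R,\alpha$ be real numbers with $0<R\le\alpha\le 1$. Then $$\rho_\alpha(R)=1-\frac R\alpha ,$$ and this value is achieved by folded Reed–Solomon codes: there is a sequence of codes $\mathrm{FRS}(n_j,k_j,l_j)$ over finite fields $F_j$, with $|F_j|>n_jl_j$, with $n_j$ and $l_j$ positive and strictly increasing in $j$ and $k_j=\lfloor Rn_j\rfloor$ (and with $Rn_j$ an integer for all $j$ if $R$ is rational, and $\alpha l_j$ an integer for all $j$ if $\alpha$ is rational), such that for every $\varepsilon>0$ there is an $m\in\mathbb N$ for which, for all sufficiently large $j$, the code $\mathrm{FRS}(n_j,k_j,l_j)$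 corrects up to some number $t\ge(1-R/\alpha-\varepsilon)n_j$ of errors under list-of-$n_j^m$ decoding when each $f_i$ reads the first $\lfloor\alpha l_j\rfloor$ symbols of the $i$-th coordinate. -/

import Mathlib

open Filter

/-- Array codes of length `n` and sub-packetization `l` over `F` are sets of words in `(F^l)^n`;
a word is a map `Fin n → Fin l → F`, whose values are its `n` coordinates (columns) in `F^l`. -/
abbrev ArrayWord (F : Type) (n l : ℕ) : Type := Fin n → Fin l → F

/-- The Hamming weight of an error: the number of its nonzero columns. -/
noncomputable def columnWeight {F : Type} [Field F] {n l : ℕ} (e : ArrayWord F n l) : ℕ :=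
  {i : Fin n | e i ≠ 0}.ncard

/-- With the reading functions `f i : F^l → F^(a i)` fixed, the code `C` corrects `t` errors under
list-of-`L` decoding: there are functions `g 1, …, g L` such that, for every codeword `c` and every
error `e` of weight at most `t`, the list `g s (f 1 (c 1 + e 1), …, f n (c n + e n))`,
`s = 1, …, L`, contains `c`. -/
def ListDecodesReading {F : Type} [Field F] {n l : ℕ} (C : Set (ArrayWord F n l))
    {a : Fin n → ℕ} (f : (i : Fin n) → (Fin l → F) → (Fin (a i) → F)) (L t : ℕ) : Prop :=
  ∃ g : Fin L → ((i : Fin n) → Fin (a i) → F) → ArrayWord F n l,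
    ∀ c ∈ C, ∀ e : ArrayWord F n l, columnWeight e ≤ t →
      ∃ s : Fin L, g s (fun i => f i (c i + e i)) = c

/-- `C` corrects up to `t` errors under list-of-`L` decoding by downloading `α n l` symbols:
the `i`-th reading function outputs `a i = α_i l` symbols, and `∑ a i ≤ α n l`. -/
def CorrectsByDownloading {F : Type} [Field F] {n l : ℕ} (C : Set (ArrayWord F n l))
    (α : ℝ) (L t : ℕ) : Prop :=
  ∃ (a : Fin n → ℕ) (f : (i : Fin n) → (Fin l → F) → (Fin (a i) → F)),
    ((∑ i, a i : ℕ) : ℝ) ≤ α * n * l ∧ ListDecodesReading C f L t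

/-- The `(α, L)`-list decoding radius of the code `C`: the largest number `t` of errors
(out of `n` coordinates) that can be corrected. -/
noncomputable def codeListRadius {F : Type} [Field F] {n l : ℕ} (C : Set (ArrayWord F n l))
    (α : ℝ) (L : ℕ) : ℕ :=
  sSup {t : ℕ | t ≤ n ∧ CorrectsByDownloading C α L t}

/-- The maximum of the `(α, L)`-list decoding radius over all codes of length `n` and dimension
`k`, i.e. over all finite fields `F`, all sub-packetizations `l ≥ 1`, and all (not necessarily
linear) codes with `|F|^(k l)` codewords. -/
noncomputable def maxListRadius (α : ℝ) (L n k : ℕ) : ℕ :=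
  sSup {r : ℕ | ∃ (F : Type) (_ : Field F) (_ : Finite F) (l : ℕ) (C : Set (ArrayWord F n l)),
    0 < l ∧ C.ncard = Nat.card F ^ (k * l) ∧ codeListRadius C α L = r}

/-- The `α`-list decoding capacity of codes of rate `R`: the supremum over `m` of
`limsup r_{α, n^m}(n, R n) / n`. When `R n` is not an integer, the dimension is `⌊R n⌋`. -/
noncomputable def alphaListCapacity (α R : ℝ) : ℝ :=
  ⨆ m : ℕ, limsup (fun n : ℕ => (maxListRadius α (n ^ m) n ⌊R * n⌋₊ : ℝ) / n) atTop

/-- The folded Reed–Solomon code `FRS(n, k, l)` with respect to `γ`: the `i`-th coordinate is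
`(h(γ^(i l)), …, h(γ^(i l + l - 1)))`, `i = 0, …, n - 1`, where `h` has degree less than `k l`. -/
def foldedRS {F : Type} [Field F] (γ : F) (n k l : ℕ) : Set (ArrayWord F n l) :=
  {c | ∃ h ∈ Polynomial.degreeLT F (k * l),
    ∀ (i : Fin n) (j : Fin l), c i j = h.eval (γ ^ ((i : ℕ) * l + j))}

/-- Reading the first `a` symbols of a coordinate. -/
def firstSymbols {F : Type} {a l : ℕ} (ha : a ≤ l) (d : Fin l → F) : Fin a → F :=
  fun j => d (Fin.castLE ha j)

theorem floor_mul_le_of_le_one {α : ℝ} (hα : α ≤ 1) (l : ℕ) : ⌊α * l⌋₊ ≤ l :=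
  Nat.floor_le_of_le (mul_le_of_le_one_left (Nat.cast_nonneg l) hα)

/-! Upper bound: some `n - t` columns carry at most their proportional share of the download, hence
at most `α (n - t) l` symbols. Errors may erase all other columns, so the list index and these
symbols determine the codeword. Counting and taking logarithms gives `k ≤ log₂ L + α (n - t)`
(`CorrectsByDownloading.mul_sub_ge`). For `L = n ^ m` the logarithm is `o(n)`, leaving `t / n ≤ 1 -
R / α` in the limit.

Lower bound: take `n = l = N` and a prime field of size `q` between `N²` and `2 N²`. The first `a =
⌊α N⌋` symbols of a block contain `a + 1 - s` windows of `s` consecutive evaluations. Interpolate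
`A₀ + ∑ A_r Y_r`, linear in the `Y_r`, through all received windows. If `h` agrees with the received
word on enough blocks, `A₀ + ∑ A_r(X) h(γ^r X)` has more roots than its degree allows, so it
vanishes (`Polynomial.ncard_agreeing_le`). This equation has at most `q^(s-1)` solutions
(`Polynomial.ncard_functional_equation_le`), a polynomial in `N` for fixed `s`, and the loss in
radius tends to 0 as `s` grows (`exists_window_length`). -/

/-! ### Counting bound for a single code -/

/-- Some `m`-element set of indices carries at most its proportional share of a sum. -/
theorem exists_card_eq_card_mul_sum_le {ι : Type*} [Fintype ι] (a : ι → ℕ) {m : ℕ}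
    (hm : m ≤ Fintype.card ι) :
    ∃ U : Finset ι, U.card = m ∧ Fintype.card ι * ∑ i ∈ U, a i ≤ m * ∑ i, a i := by
  classical
  induction hd : Fintype.card ι - m generalizing m with
  | zero =>
    have : m = Fintype.card ι := by omega
    subst this
    exact ⟨Finset.univ, Finset.card_univ, le_rfl⟩
  | succ d ih =>
    obtain ⟨U, hU, hsum⟩ := ih (m := m + 1) (by omega) (by omega)
    -- Dropping a largest entry does not raise the average.
    obtain ⟨x, hx, hmax⟩ := U.exists_max_image a (Finset.card_pos.1 (by omega))
    refine ⟨U.erase x, by rw [Finset.card_erase_of_mem hx]; omega, ?_⟩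
    have h1 := Finset.add_sum_erase U a hx
    have h2 : ∑ i ∈ U.erase x, a i ≤ m * a x := by
      have := Finset.sum_le_card_nsmul (U.erase x) a (a x)
        fun i hi => hmax i (Finset.mem_of_mem_erase hi)
      rwa [Finset.card_erase_of_mem hx, hU, smul_eq_mul] at this
    rw [← h1] at hsum
    have h3 : (m + 1) * (Fintype.card ι * ∑ i ∈ U.erase x, a i) ≤ (m + 1) * (m * ∑ i, a i) :=
      calc (m + 1) * (Fintype.card ι * ∑ i ∈ U.erase x, a i)
          = Fintype.card ι * (m * ∑ i ∈ U.erase x, a i + ∑ i ∈ U.erase x, a i) := by ring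
        _ ≤ Fintype.card ι * (m * ∑ i ∈ U.erase x, a i + m * a x) := by gcongr
        _ = m * (Fintype.card ι * (a x + ∑ i ∈ U.erase x, a i)) := by ring
        _ ≤ m * ((m + 1) * ∑ i, a i) := by gcongr
        _ = (m + 1) * (m * ∑ i, a i) := by ring
    exact Nat.le_of_mul_le_mul_left h3 (Nat.succ_pos m)

/-- If all columns outside `U` may be erased, the code is described by the list index and by the
symbols read inside `U`. -/
theorem ListDecodesReading.ncard_le {F : Type} [Field F] [Finite F] {n l : ℕ}
    {C : Set (ArrayWord F n l)} {a : Fin n → ℕ} {f : (i : Fin n) → (Fin l → F) → (Fin (a i) → F)}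
    {L t : ℕ} (h : ListDecodesReading C f L t) (U : Finset (Fin n)) (hU : n ≤ U.card + t) :
    C.ncard ≤ L * Nat.card F ^ ∑ i ∈ U, a i := by
  classical
  obtain ⟨g, hg⟩ := h
  -- Outside `U` the error is `-c i`, so the decoder sees `f i 0` there.
  let φ : Fin L × ((i : U) → Fin (a i) → F) → ArrayWord F n l := fun p =>
    g p.1 fun i => if hi : i ∈ U then p.2 ⟨i, hi⟩ else f i 0
  have hsub : C ⊆ Set.range φ := by
    intro c hc
    obtain ⟨s, hs⟩ := hg c hc (fun i => if i ∈ U then 0 else -c i) (by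
      have hss : {i : Fin n | (if i ∈ U then 0 else -c i) ≠ 0} ⊆ ((Uᶜ : Finset (Fin n)) : Set _) := by
        intro i hi
        simp only [Set.mem_ofPred_eq] at hi
        simp only [Finset.coe_compl, Set.mem_compl_iff, Finset.mem_coe]
        intro hiU
        simp [hiU] at hi
      refine (Set.ncard_le_ncard hss (Finset.finite_toSet _)).trans ?_
      rw [Set.ncard_coe_finset, Finset.card_compl, Fintype.card_fin]
      omega)
    refine ⟨(s, fun i => f i (c i)), ?_⟩
    refine Eq.trans ?_ hs
    simp only [φ]
    congr 1
    funext i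
    by_cases hi : i ∈ U <;> simp [hi]
  calc C.ncard ≤ (Set.range φ).ncard := Set.ncard_le_ncard hsub (Set.toFinite _)
    _ ≤ Nat.card (Fin L × ((i : U) → Fin (a i) → F)) := by
        rw [← Set.image_univ, ← Set.ncard_univ]
        exact Set.ncard_image_le (Set.toFinite _)
    _ = L * Nat.card F ^ ∑ i ∈ U, a i := by
        rw [Nat.card_prod, Nat.card_pi]
        simp only [Nat.card_fun, Nat.card_eq_fintype_card, Fintype.card_fin]
        rw [Finset.prod_pow_eq_pow_sum, Finset.sum_coe_sort U a]

/-- Since `log₂ |F| ≥ 1` and `l ≥ 1`, dividing the logarithmic count by `l log₂ |F|` can only shrink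
the list term; the bound is thus uniform in the field and in `l`. -/
theorem CorrectsByDownloading.mul_sub_ge {F : Type} [Field F] [Finite F] {n l k : ℕ} (hl : 0 < l)
    {C : Set (ArrayWord F n l)} (hC : C.ncard = Nat.card F ^ (k * l)) {α : ℝ}
    {L t : ℕ} (ht : t ≤ n) (h : CorrectsByDownloading C α L t) :
    (k : ℝ) ≤ Real.logb 2 L + α * (n - t) := by
  obtain ⟨a, f, ha, hf⟩ := h
  -- The averaging argument below divides by `n`.
  rcases Nat.eq_zero_or_pos n with rfl | hn
  · obtain rfl : t = 0 := by omega
    have := hf.ncard_le ∅ (by simp)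
    rw [hC] at this
    simp only [Finset.sum_empty, pow_zero, mul_one] at this
    have hq : 2 ≤ Nat.card F := Finite.one_lt_card
    have h1 : 2 ^ k ≤ L := (Nat.pow_le_pow_right two_pos (Nat.le_mul_of_pos_right k hl)).trans
      ((Nat.pow_le_pow_left hq _).trans this)
    have h2 : (k : ℝ) ≤ Real.logb 2 L := by
      rw [Real.le_logb_iff_rpow_le one_lt_two]
      · rw [Real.rpow_natCast]; exact_mod_cast h1
      · exact_mod_cast (pow_pos two_pos k).trans_le h1
    simpa using h2
  obtain ⟨U, hUc, hU⟩ := exists_card_eq_card_mul_sum_le a (m := n - t) (by simp)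
  rw [Fintype.card_fin] at hU
  have hcard := hf.ncard_le U (by omega)
  rw [hC] at hcard
  have hq : 2 ≤ Nat.card F := Finite.one_lt_card
  set q := Nat.card F
  set S := ∑ i ∈ U, a i
  have hS : (S : ℝ) ≤ α * (n - t) * l := by
    have h1 : (n : ℝ) * S ≤ (n - t) * (∑ i, a i : ℕ) := by
      rw [← Nat.cast_sub ht]; exact_mod_cast hU
    have h2 : (n : ℝ) * S ≤ n * (α * (n - t) * l) := by
      have h3 : (0 : ℝ) ≤ n - t := by rw [sub_nonneg]; exact_mod_cast ht
      calc (n : ℝ) * S ≤ (n - t) * (α * n * l) := h1.trans (by gcongr)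
        _ = _ := by ring
    exact le_of_mul_le_mul_left h2 (by exact_mod_cast hn)
  have hL : 0 < L := by
    rcases Nat.eq_zero_or_pos L with rfl | h
    · have : 0 < q ^ (k * l) := pow_pos (by omega) _
      omega
    · exact h
  have hqR : (2 : ℝ) ≤ q := by exact_mod_cast hq
  have hlog2 : 1 ≤ Real.logb 2 q := by
    rw [Real.le_logb_iff_rpow_le one_lt_two (by linarith)]; simpa using hqR
  have hLlog : 0 ≤ Real.logb 2 L := Real.logb_nonneg one_lt_two (by exact_mod_cast hL)
  have hlog : (k * l : ℝ) * Real.logb 2 q ≤ Real.logb 2 L + S * Real.logb 2 q := by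
    have h1 : ((q : ℝ) ^ (k * l)) ≤ L * (q : ℝ) ^ S := by exact_mod_cast hcard
    have h2 := Real.logb_le_logb_of_le one_lt_two (by positivity) h1
    rw [Real.logb_mul (by positivity) (by positivity), Real.logb_pow, Real.logb_pow] at h2
    exact_mod_cast h2
  have hl1 : (1 : ℝ) ≤ l := by exact_mod_cast hl
  have hkl : (k * l : ℝ) ≤ Real.logb 2 L + S := by
    have h3 : (k * l : ℝ) * Real.logb 2 q ≤ (Real.logb 2 L + S) * Real.logb 2 q := by
      nlinarith
    exact le_of_mul_le_mul_right h3 (by linarith)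
  have h4 : (k : ℝ) * l ≤ (Real.logb 2 L + α * (n - t)) * l := by nlinarith
  exact le_of_mul_le_mul_right h4 (by linarith)

/-! ### Radii as suprema, and the upper bound on the capacity -/

theorem codeListRadius_le {F : Type} [Field F] {n l : ℕ} (C : Set (ArrayWord F n l))
    (α : ℝ) (L : ℕ) : codeListRadius C α L ≤ n :=
  csSup_le' fun _ h => h.1

theorem maxListRadius_le (α : ℝ) (L n k : ℕ) : maxListRadius α L n k ≤ n := by
  refine csSup_le' ?_
  rintro _ ⟨F, _, _, l, C, -, -, rfl⟩
  exact codeListRadius_le C α L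

theorem le_codeListRadius {F : Type} [Field F] {n l : ℕ} {C : Set (ArrayWord F n l)}
    {α : ℝ} {L t : ℕ} (ht : t ≤ n) (h : CorrectsByDownloading C α L t) :
    t ≤ codeListRadius C α L :=
  le_csSup ⟨n, fun _ h => h.1⟩ ⟨ht, h⟩

theorem codeListRadius_le_maxListRadius {F : Type} [Field F] [Finite F] {n l k : ℕ} (hl : 0 < l)
    {C : Set (ArrayWord F n l)} (hC : C.ncard = Nat.card F ^ (k * l)) (α : ℝ) (L : ℕ) :
    codeListRadius C α L ≤ maxListRadius α L n k := by
  refine le_csSup ⟨n, ?_⟩ ⟨F, inferInstance, inferInstance, l, C, hl, hC, rfl⟩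
  rintro _ ⟨F, _, _, l, C, -, -, rfl⟩
  exact codeListRadius_le C α L

theorem codeListRadius_eq_zero_or_corrects {F : Type} [Field F] {n l : ℕ}
    (C : Set (ArrayWord F n l)) (α : ℝ) (L : ℕ) :
    codeListRadius C α L = 0 ∨ CorrectsByDownloading C α L (codeListRadius C α L) := by
  rcases Set.eq_empty_or_nonempty {t : ℕ | t ≤ n ∧ CorrectsByDownloading C α L t} with h | h
  · left; rw [codeListRadius, h]; simp
  · right; exact (Nat.sSup_mem h ⟨n, fun _ h => h.1⟩).2

theorem maxListRadius_floor_le {R α : ℝ} (hR : 0 < R) (hRα : R ≤ α) (m : ℕ) {n : ℕ} (hn : 0 < n) :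
    (maxListRadius α (n ^ m) n ⌊R * n⌋₊ : ℝ) ≤
      (1 - R / α) * n + (1 + m * Real.logb 2 n) / α := by
  have hα : 0 < α := hR.trans_le hRα
  have hlog : 0 ≤ Real.logb 2 n := Real.logb_nonneg one_lt_two (by exact_mod_cast hn)
  have hRα' : 0 ≤ 1 - R / α := by rw [sub_nonneg, div_le_one hα]; exact hRα
  have h0 : 0 ≤ (1 - R / α) * n + (1 + m * Real.logb 2 n) / α := by positivity
  rw [← Nat.le_floor_iff h0]
  refine csSup_le' ?_
  rintro _ ⟨F, _, _, l, C, hl, hC, rfl⟩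
  rw [Nat.le_floor_iff h0]
  -- The radius is also 0 when no `t` is admissible, as the supremum of the empty set; then only
  -- nonnegativity of the bound is needed.
  rcases codeListRadius_eq_zero_or_corrects C α (n ^ m) with h | h
  · rw [h]; simpa using h0
  · have h1 := h.mul_sub_ge hl hC (codeListRadius_le C α _)
    have h2 := Nat.lt_floor_add_one (R * n)
    rw [Nat.cast_pow, Real.logb_pow] at h1
    set r : ℝ := (codeListRadius C α (n ^ m) : ℝ)
    have h3 : α * r ≤ α * ((1 - R / α) * n + (1 + m * Real.logb 2 n) / α) := by
      have : α * ((1 - R / α) * n + (1 + m * Real.logb 2 n) / α)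
          = α * n - R * n + (1 + m * Real.logb 2 n) := by field_simp
      rw [this]; linarith
    exact le_of_mul_le_mul_left h3 hα

theorem maxListRadius_div_le_one (α : ℝ) (L n k : ℕ) : (maxListRadius α L n k : ℝ) / n ≤ 1 :=
  div_le_one_of_le₀ (by exact_mod_cast maxListRadius_le α L n k) (Nat.cast_nonneg n)

theorem isBoundedUnder_maxListRadius_div (α R : ℝ) (m : ℕ) :
    IsBoundedUnder (· ≤ ·) atTop
      fun n : ℕ => (maxListRadius α (n ^ m) n ⌊R * n⌋₊ : ℝ) / n :=
  isBoundedUnder_of ⟨1, fun _ => maxListRadius_div_le_one _ _ _ _⟩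

theorem limsup_maxListRadius_div_le {R α : ℝ} (hR : 0 < R) (hRα : R ≤ α) (m : ℕ) :
    limsup (fun n : ℕ => (maxListRadius α (n ^ m) n ⌊R * n⌋₊ : ℝ) / n) atTop ≤ 1 - R / α := by
  have hlim : Tendsto (fun n : ℕ => (1 - R / α) + (1 / (n : ℝ) + m * (Real.log n / n) / Real.log 2) / α)
      atTop (nhds ((1 - R / α) + (0 + m * 0 / Real.log 2) / α)) := by
    have h1 : Tendsto (fun n : ℕ => 1 / (n : ℝ)) atTop (nhds 0) := tendsto_one_div_atTop_nhds_zero_nat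
    have h2 : Tendsto (fun n : ℕ => Real.log n / (n : ℝ)) atTop (nhds 0) :=
      (Real.isLittleO_log_id_atTop.tendsto_div_nhds_zero).comp tendsto_natCast_atTop_atTop
    exact tendsto_const_nhds.add ((h1.add ((h2.const_mul _).div_const _)).div_const _)
  have h := hlim.limsup_eq
  simp only [mul_zero, zero_div, add_zero] at h
  rw [← h]
  refine limsup_le_limsup ?_ ?_ hlim.isBoundedUnder_le
  · filter_upwards [eventually_gt_atTop 0] with n hn
    have hn' : (0 : ℝ) < n := by exact_mod_cast hn
    rw [div_le_iff₀ hn']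
    refine (maxListRadius_floor_le hR hRα m hn).trans (le_of_eq ?_)
    rw [Real.logb]
    have : (0 : ℝ) < Real.log 2 := Real.log_pos one_lt_two
    have : 0 < α := hR.trans_le hRα
    field_simp
  · exact IsBoundedUnder.isCoboundedUnder_le (isBoundedUnder_of ⟨0, fun n => by positivity⟩)

/-! ### Interpolation and the functional equation -/

open Polynomial in
/-- The coefficients of the dilated polynomial `h(γ^r X)`. -/
theorem Polynomial.coeff_comp_C_pow_mul_X {F : Type*} [Field F] (h : F[X]) (γ : F) (r u : ℕ) :
    (h.comp (C (γ ^ r) * X)).coeff u = h.coeff u * (γ ^ u) ^ r := by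
  rw [Polynomial.comp_C_mul_X_coeff, ← pow_mul, ← pow_mul, mul_comm u r]

open Polynomial in
/-- A homogeneous linear functional equation `∑ A_r(X) d(γ^r X) = 0` with some `A_r ≠ 0` has
at most `s - 1` free coefficients among the first `K ≤ ord γ`. -/
theorem Polynomial.exists_free_coeffs {F : Type*} [Field F] {γ : F} {K s : ℕ}
    (hγ : Set.InjOn (fun r : ℕ => γ ^ r) (Set.Iio K)) (A : Fin s → F[X]) (hA : A ≠ 0) :
    ∃ Z : Finset ℕ, Z.card ≤ s - 1 ∧ ∀ d : F[X], d ∈ degreeLT F K →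
      ∑ r, A r * d.comp (C (γ ^ (r : ℕ)) * X) = 0 → (∀ u ∈ Z, d.coeff u = 0) → d = 0 := by
  classical
  have hex : ∃ v, ∃ r, (A r).coeff v ≠ 0 := by
    obtain ⟨r, hr⟩ := Function.ne_iff.1 hA
    obtain ⟨v, hv⟩ : ∃ v, (A r).coeff v ≠ 0 := by
      by_contra! hcon
      exact hr (Polynomial.ext fun v => by simpa using hcon v)
    exact ⟨v, r, hv⟩
  -- With `v` the lowest degree occurring in any `A_r`, the coefficient of `X^(v+u)` involves only
  -- `d_0, …, d_u`, and `d_u` enters with factor `B(γ^u)`. So `d_u` is forced by the earlier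
  -- coefficients unless `γ^u` is one of the at most `s - 1` roots of `B`.
  let v := Nat.find hex
  obtain ⟨r₀, hr₀⟩ := Nat.find_spec hex
  have hmin : ∀ w < v, ∀ r, (A r).coeff w = 0 := fun w hw r => by
    by_contra hne; exact Nat.find_min hex hw ⟨r, hne⟩
  let B : F[X] := ∑ r : Fin s, C ((A r).coeff v) * X ^ (r : ℕ)
  have hBc : B.coeff r₀ = (A r₀).coeff v := by
    simp only [B, finsetSum_coeff, coeff_C_mul, coeff_X_pow, mul_ite, mul_one, mul_zero]
    rw [Finset.sum_eq_single r₀]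
    · simp
    · intro b _ hb
      rw [if_neg]
      intro h
      exact hb (Fin.ext h.symm)
    · simp
  have hB0 : B ≠ 0 := fun h => hr₀ (by rw [← hBc, h, coeff_zero])
  have hBd : B.natDegree ≤ s - 1 := by
    refine natDegree_sum_le_of_forall_le _ _ fun r _ => ?_
    exact (natDegree_C_mul_X_pow_le _ _).trans (by have := r.2; omega)
  refine ⟨(Finset.range K).filter fun u => B.eval (γ ^ u) = 0, ?_, ?_⟩
  · refine le_trans ?_ ((card_roots' B).trans hBd)
    refine le_trans ?_ (Multiset.toFinset_card_le _)
    refine Finset.card_le_card_of_injOn (fun r => γ ^ r) ?_ ?_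
    · intro u hu
      simp only [Finset.coe_filter, Finset.mem_range, Set.mem_ofPred_eq] at hu
      simp [hB0, hu.2]
    · exact hγ.mono fun u hu => by simpa using (Finset.mem_filter.1 (Finset.mem_coe.1 hu)).1
  · intro d hd heq hZ
    have hco : ∀ u, d.coeff u = 0 := by
      intro u
      induction u using Nat.strong_induction_on with
      | _ u ih =>
        by_cases hu : u < K
        swap
        · rw [mem_degreeLT] at hd
          exact coeff_eq_zero_of_degree_lt (hd.trans_le (by exact_mod_cast not_lt.1 hu))
        have h1 := congrArg (fun p => coeff p (v + u)) heq
        simp only [finsetSum_coeff, coeff_zero] at h1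
        have h2 : ∀ r : Fin s, (A r * d.comp (C (γ ^ (r : ℕ)) * X)).coeff (v + u)
            = (A r).coeff v * (γ ^ u) ^ (r : ℕ) * d.coeff u := by
          intro r
          rw [coeff_mul, Finset.sum_eq_single (v, u)]
          · rw [coeff_comp_C_pow_mul_X]; ring
          · rintro ⟨x, y⟩ hxy hne
            rw [Finset.HasAntidiagonal.mem_antidiagonal] at hxy
            simp only at hxy ⊢
            rcases lt_or_ge x v with hx | hx
            · rw [hmin x hx, zero_mul]
            · have : y < u := by
                rcases hx.eq_or_lt with rfl | hx
                · exact absurd (Nat.add_left_cancel hxy) fun h => hne (by rw [h])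
                · omega
              rw [coeff_comp_C_pow_mul_X, ih y this, zero_mul, mul_zero]
          · intro hn; exact absurd (Finset.HasAntidiagonal.mem_antidiagonal.2 (rfl : v + u = v + u)) hn
        simp only [h2, ← Finset.sum_mul] at h1
        have h3 : B.eval (γ ^ u) = ∑ r : Fin s, (A r).coeff v * (γ ^ u) ^ (r : ℕ) := by
          simp [B, eval_finsetSum]
        rw [← h3] at h1
        rcases mul_eq_zero.1 h1 with h | h
        · exact hZ u (Finset.mem_filter.2 ⟨Finset.mem_range.2 hu, h⟩)
        · exact h
    exact Polynomial.ext fun u => by rw [hco, coeff_zero]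

open Polynomial in
/-- The solutions of `A₀ + ∑ A_r(X) h(γ^r X) = 0` of degree less than `K` number at most
`|F|^(s-1)`. -/
theorem Polynomial.ncard_functional_equation_le {F : Type*} [Field F] [Finite F] {γ : F} {K s : ℕ}
    (hγ : Set.InjOn (fun r : ℕ => γ ^ r) (Set.Iio K)) (A₀ : F[X]) (A : Fin s → F[X]) (hA : A ≠ 0) :
    {h : F[X] | h ∈ degreeLT F K ∧
      A₀ + ∑ r, A r * h.comp (C (γ ^ (r : ℕ)) * X) = 0}.ncard ≤ Nat.card F ^ (s - 1) := by
  obtain ⟨Z, hZ, huniq⟩ := exists_free_coeffs hγ A hA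
  let φ : F[X] → Z → F := fun h u => h.coeff u
  have hinj : Set.InjOn φ {h : F[X] | h ∈ degreeLT F K ∧
      A₀ + ∑ r, A r * h.comp (C (γ ^ (r : ℕ)) * X) = 0} := by
    rintro h ⟨hd, he⟩ h' ⟨hd', he'⟩ hφ
    rw [← sub_eq_zero]
    refine huniq _ (Submodule.sub_mem _ hd hd') ?_ fun u hu => ?_
    · simp only [sub_comp, mul_sub, Finset.sum_sub_distrib]
      linear_combination he - he'
    · rw [coeff_sub, sub_eq_zero]
      exact congrFun hφ ⟨u, hu⟩
  rw [← hinj.ncard_image]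
  calc _ ≤ (Set.univ : Set (Z → F)).ncard := Set.ncard_le_ncard (Set.subset_univ _) (Set.toFinite _)
    _ = Nat.card F ^ Z.card := by rw [Set.ncard_univ, Nat.card_fun]; simp
    _ ≤ _ := Nat.pow_le_pow_right Nat.card_pos hZ

open Polynomial in
/-- Interpolation: `N` linear conditions on `A₀` (degree less than `E`) and `A_r`
(degree less than `D`) leave a nonzero solution when `N < E + s D`. -/
theorem Polynomial.exists_interpolant {F : Type*} [Field F] {s D E : ℕ} {ι : Type*} [Fintype ι]
    (hN : Fintype.card ι < E + s * D) (x : ι → F) (y : ι → Fin s → F) :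
    ∃ (A₀ : F[X]) (A : Fin s → F[X]), A₀ ∈ degreeLT F E ∧ (∀ r, A r ∈ degreeLT F D) ∧
      (A₀ ≠ 0 ∨ A ≠ 0) ∧ ∀ i, A₀.eval (x i) + ∑ r, (A r).eval (x i) * y i r = 0 := by
  let V := degreeLT F E × (Fin s → degreeLT F D)
  let ev : ι → F[X] →ₗ[F] F := fun i => Polynomial.leval (x i)
  let T : V →ₗ[F] (ι → F) := LinearMap.pi fun i =>
    (ev i ∘ₗ (degreeLT F E).subtype ∘ₗ LinearMap.fst F _ _) +
      ∑ r, y i r • (ev i ∘ₗ (degreeLT F D).subtype ∘ₗ LinearMap.proj r ∘ₗ LinearMap.snd F _ _)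
  have e1 : ∀ m, Module.finrank F (degreeLT F m) = m := fun m => by
    rw [(degreeLTEquiv F m).finrank_eq]; simp
  have : ∀ m, Module.Finite F (degreeLT F m) := fun m =>
    Module.Finite.equiv (degreeLTEquiv F m).symm
  have hlt : Module.finrank F (ι → F) < Module.finrank F V := by
    simp only [V]
    rw [Module.finrank_prod]
    simp only [Module.finrank_pi_fintype, Module.finrank_self, mul_one, e1, Finset.sum_const, Finset.card_univ, Fintype.card_fin, smul_eq_mul]
    exact hN
  obtain ⟨p, hp, hp0⟩ := (Submodule.ne_bot_iff _).1 (LinearMap.ker_ne_bot_of_finrank_lt (f := T) hlt)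
  refine ⟨p.1, fun r => p.2 r, p.1.2, fun r => (p.2 r).2, ?_, fun i => ?_⟩
  · by_contra! hcon
    refine hp0 (Prod.ext (Subtype.ext hcon.1) ?_)
    funext r
    exact Subtype.ext (congrFun hcon.2 r)
  · have := congrFun (LinearMap.mem_ker.1 hp) i
    simp only [T, LinearMap.pi_apply, LinearMap.add_apply, LinearMap.sum_apply,
      LinearMap.smul_apply, LinearMap.comp_apply, Pi.zero_apply] at this
    change (p.1 : F[X]).eval (x i) + ∑ r, y i r * (p.2 r : F[X]).eval (x i) = 0 at this
    simpa only [mul_comm] using this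

open Polynomial in
/-- A polynomial vanishing on the first `w` points of each block of `G` is zero when its degree is
less than the number of these points. -/
theorem Polynomial.eq_zero_of_eval_blocks {F : Type*} [Field F] {γ : F} {n l w : ℕ} (hw : w ≤ l)
    (hγ : Set.InjOn (fun r : ℕ => γ ^ r) (Set.Iio (n * l))) {G : Finset (Fin n)} {E : ℕ}
    (hE : E ≤ G.card * w) {P : F[X]} (hP : P ∈ degreeLT F E)
    (h0 : ∀ i ∈ G, ∀ j < w, P.eval (γ ^ ((i : ℕ) * l + j)) = 0) : P = 0 := by
  refine eq_zero_of_degree_lt_of_eval_index_eq_zero (s := G ×ˢ Finset.range w)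
    (v := fun p : Fin n × ℕ => γ ^ ((p.1 : ℕ) * l + p.2)) ?_ ?_ ?_
  · rintro ⟨i, j⟩ h ⟨i', j'⟩ h' heq
    simp only [Finset.coe_product, Set.mem_prod, Finset.mem_coe, Finset.mem_range] at h h'
    have hlt : ∀ (x : Fin n) (y : ℕ), y < w → (x : ℕ) * l + y < n * l := fun x y hy =>
      calc (x : ℕ) * l + y < (x : ℕ) * l + l := by omega
        _ = (x + 1) * l := by ring
        _ ≤ n * l := Nat.mul_le_mul_right _ x.2
    have he := hγ (hlt i j h.2) (hlt i' j' h'.2) heq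
    have hl : 0 < l := by omega
    -- Offsets are below `l`, so division by `l` recovers the block.
    have h1 : (i : ℕ) = i' := by
      have h2 := congrArg (· / l) he
      simpa [mul_comm _ l, Nat.mul_add_div hl, Nat.div_eq_of_lt (h.2.trans_le hw),
        Nat.div_eq_of_lt (h'.2.trans_le hw)] using h2
    rw [h1] at he
    exact Prod.ext (Fin.ext h1) (by simpa using he)
  · rw [Finset.card_product, Finset.card_range]
    exact (mem_degreeLT.1 hP).trans_le (by exact_mod_cast hE)
  · rintro ⟨i, j⟩ h
    rw [Finset.mem_product, Finset.mem_range] at h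
    exact h0 i h.1 j h.2

open Polynomial in
theorem Polynomial.mul_comp_mem_degreeLT {F : Type*} [Field F] {A h : F[X]} {D K : ℕ} (c : F)
    (hA : A ∈ degreeLT F D) (hh : h ∈ degreeLT F K) :
    A * h.comp (C c * X) ∈ degreeLT F (D + K) := by
  rw [mem_degreeLT, degree_lt_iff_coeff_zero] at *
  intro m hm
  rw [coeff_mul]
  refine Finset.sum_eq_zero fun p hp => ?_
  rw [Finset.HasAntidiagonal.mem_antidiagonal] at hp
  rw [comp_C_mul_X_coeff]
  rcases lt_or_ge p.1 D with h1 | h1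
  · rw [hh p.2 (by omega), zero_mul, mul_zero]
  · rw [hA p.1 h1, zero_mul]

theorem Polynomial.finite_degreeLT {F : Type*} [Field F] [Finite F] (m : ℕ) :
    (Polynomial.degreeLT F m : Set (Polynomial F)).Finite :=
  Set.finite_coe_iff.1 (Finite.of_equiv (Fin m → F) (Polynomial.degreeLTEquiv F m).symm.toEquiv)

open Polynomial in
/-- Linear-algebraic list decoding with windows of length `s` inside the first `a` symbols of each
block. -/
theorem Polynomial.ncard_agreeing_le {F : Type*} [Field F] [Finite F] {γ : F} {n l k a s D t : ℕ}
    (ha : a ≤ l) (hk : k ≤ n) (hγ : Set.InjOn (fun r : ℕ => γ ^ r) (Set.Iio (n * l)))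
    (hs : 0 < s) (hD : n * (a + 1 - s) < D + k * l + s * D)
    (ht : D + k * l ≤ (n - t) * (a + 1 - s)) (y : Fin n → Fin a → F) :
    {h : F[X] | h ∈ degreeLT F (k * l) ∧
      {i : Fin n | ¬ ∀ j : Fin a, h.eval (γ ^ ((i : ℕ) * l + j)) = y i j}.ncard ≤ t}.ncard
      ≤ Nat.card F ^ (s - 1) := by
  classical
  set w := a + 1 - s with hw
  have hidx : ∀ (j : Fin w) (r : Fin s), (j : ℕ) + r < a := fun j r => by
    have := j.2; have := r.2; omega
  -- Giving `A₀` the bound `D + k * l` costs nothing: the products `A_r(X) h(γ^r X)` already reach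
  -- it.
  obtain ⟨A₀, A, hA₀, hA, hne, heq⟩ := exists_interpolant (F := F) (ι := Fin n × Fin w) (s := s)
    (D := D) (E := D + k * l) (by simpa using hD) (fun p => γ ^ ((p.1 : ℕ) * l + p.2))
    (fun p r => y p.1 ⟨p.2 + r, hidx p.2 r⟩)
  have hsol : {h : F[X] | h ∈ degreeLT F (k * l) ∧
      {i : Fin n | ¬ ∀ j : Fin a, h.eval (γ ^ ((i : ℕ) * l + j)) = y i j}.ncard ≤ t} ⊆
      {h : F[X] | h ∈ degreeLT F (k * l) ∧
        A₀ + ∑ r, A r * h.comp (C (γ ^ (r : ℕ)) * X) = 0} := by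
    rintro h ⟨hd, hbad⟩
    refine ⟨hd, ?_⟩
    let G : Finset (Fin n) :=
      Finset.univ.filter fun i => ∀ j : Fin a, h.eval (γ ^ ((i : ℕ) * l + j)) = y i j
    have hG : n - t ≤ G.card := by
      have h1 := Finset.card_filter_add_card_filter_not (s := (Finset.univ : Finset (Fin n)))
        (fun i => ∀ j : Fin a, h.eval (γ ^ ((i : ℕ) * l + j)) = y i j)
      have h2 : {i : Fin n | ¬ ∀ j : Fin a, h.eval (γ ^ ((i : ℕ) * l + j)) = y i j}.ncard =
          (Finset.univ.filter fun i : Fin n =>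
            ¬ ∀ j : Fin a, h.eval (γ ^ ((i : ℕ) * l + j)) = y i j).card := by
        rw [← Set.ncard_coe_finset]; congr 1; ext; simp
      rw [Finset.card_univ, Fintype.card_fin] at h1
      simp only [G]
      omega
    refine eq_zero_of_eval_blocks (w := w) (by omega) hγ (G := G) (E := D + k * l)
      (ht.trans (Nat.mul_le_mul_right _ hG)) ?_ ?_
    · exact Submodule.add_mem _ hA₀ (Submodule.sum_mem _ fun r _ =>
        mul_comp_mem_degreeLT _ (hA r) hd)
    · intro i hi j hj
      have hi' := (Finset.mem_filter.1 hi).2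
      rw [← heq (i, ⟨j, hj⟩), eval_add, eval_finsetSum]
      congr 1
      refine Finset.sum_congr rfl fun r _ => ?_
      rw [eval_mul, eval_comp, ← hi' ⟨j + r, hidx ⟨j, hj⟩ r⟩]
      simp only [eval_mul, eval_C, eval_X, ← pow_add]
      congr 3
      ring
  -- If all `A_r` vanish, any solution would force `A₀ = 0`, contrary to nontriviality; the list is
  -- then empty.
  by_cases hA0 : A = 0
  · have hA₀' : A₀ ≠ 0 := hne.resolve_right (not_not.2 hA0)
    have : {h : F[X] | h ∈ degreeLT F (k * l) ∧
        {i : Fin n | ¬ ∀ j : Fin a, h.eval (γ ^ ((i : ℕ) * l + j)) = y i j}.ncard ≤ t} = ∅ := by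
      refine Set.eq_empty_of_forall_notMem fun h hh => hA₀' ?_
      simpa [hA0] using (hsol hh).2
    rw [this, Set.ncard_empty]
    exact Nat.zero_le _
  · refine (Set.ncard_le_ncard hsol ((finite_degreeLT (k * l)).subset fun h hh => hh.1)).trans ?_
    exact ncard_functional_equation_le
      (hγ.mono (Set.Iio_subset_Iio (Nat.mul_le_mul_right l hk))) A₀ A hA0

/-! ### Decoding folded Reed–Solomon codes -/

/-- A code list-decodes when few codewords agree with any received word off `t` columns. -/
theorem listDecodesReading_of_ncard_le {F : Type} [Field F] [Finite F] {n l : ℕ}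
    {C : Set (ArrayWord F n l)} {a : Fin n → ℕ} {f : (i : Fin n) → (Fin l → F) → (Fin (a i) → F)}
    {L t : ℕ} (h : ∀ y : (i : Fin n) → Fin (a i) → F,
      {c | c ∈ C ∧ {i | f i (c i) ≠ y i}.ncard ≤ t}.ncard ≤ L) :
    ListDecodesReading C f L t := by
  have hex : ∀ y : (i : Fin n) → Fin (a i) → F, ∃ G : Fin L → ArrayWord F n l,
      {c | c ∈ C ∧ {i | f i (c i) ≠ y i}.ncard ≤ t} ⊆ Set.range G := by
    intro y
    set S := {c | c ∈ C ∧ {i | f i (c i) ≠ y i}.ncard ≤ t}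
    have : Finite S := Set.toFinite S
    let e : S ≃ Fin S.ncard := Finite.equivFinOfCardEq rfl
    -- Unused list positions are padded with the zero word.
    refine ⟨fun i => if hi : (i : ℕ) < S.ncard then (e.symm ⟨i, hi⟩ : ArrayWord F n l) else 0, ?_⟩
    intro c hc
    refine ⟨Fin.castLE (h y) (e ⟨c, hc⟩), ?_⟩
    simp only [Fin.val_castLE, Fin.eta, Equiv.symm_apply_apply]
    exact dif_pos (e ⟨c, hc⟩).is_lt
  choose G hG using hex
  refine ⟨fun s y => G y s, fun c hc e he => ?_⟩
  refine hG (fun i => f i (c i + e i)) ⟨hc, le_trans (Set.ncard_le_ncard ?_ (Set.toFinite _)) he⟩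
  intro i hi h0
  exact hi (by simp [h0])

/-- The encoder of the folded Reed–Solomon code. -/
def foldedEval {F : Type} [Field F] (γ : F) (n l : ℕ) (h : Polynomial F) : ArrayWord F n l :=
  fun i j => h.eval (γ ^ ((i : ℕ) * l + j))

theorem foldedRS_eq_image {F : Type} [Field F] (γ : F) (n k l : ℕ) :
    foldedRS γ n k l = foldedEval γ n l '' (Polynomial.degreeLT F (k * l)) := by
  ext c
  constructor
  · rintro ⟨h, hd, hc⟩
    exact ⟨h, hd, funext fun i => funext fun j => (hc i j).symm⟩
  · rintro ⟨h, hd, rfl⟩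
    exact ⟨h, hd, fun _ _ => rfl⟩

theorem ncard_foldedRS {F : Type} [Field F] [Finite F] {γ : F} {n k l : ℕ} (hk : k ≤ n)
    (hγ : Set.InjOn (fun r : ℕ => γ ^ r) (Set.Iio (n * l))) :
    (foldedRS γ n k l).ncard = Nat.card F ^ (k * l) := by
  rw [foldedRS_eq_image, Set.InjOn.ncard_image]
  · rw [← Nat.card_coe_set_eq]
    exact (Nat.card_congr (Polynomial.degreeLTEquiv F (k * l)).toEquiv).trans
      (by rw [Nat.card_fun]; simp)
  · intro h hd h' hd' heq
    rw [← sub_eq_zero]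
    refine Polynomial.eq_zero_of_eval_blocks (w := l) le_rfl hγ (G := Finset.univ) (E := k * l)
      (by simpa using Nat.mul_le_mul_right l hk) (Submodule.sub_mem _ hd hd') ?_
    intro i _ j hj
    have := congrFun (congrFun heq i) ⟨j, hj⟩
    simp only [foldedEval] at this
    rw [Polynomial.eval_sub, this, sub_self]

theorem foldedRS_listDecodesReading {F : Type} [Field F] [Finite F] {γ : F} {n l k a s D t L : ℕ}
    (ha : a ≤ l) (hk : k ≤ n) (hγ : Set.InjOn (fun r : ℕ => γ ^ r) (Set.Iio (n * l)))
    (hs : 0 < s) (hD : n * (a + 1 - s) < D + k * l + s * D)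
    (ht : D + k * l ≤ (n - t) * (a + 1 - s)) (hL : Nat.card F ^ (s - 1) ≤ L) :
    ListDecodesReading (foldedRS γ n k l) (fun _ => firstSymbols ha) L t := by
  refine listDecodesReading_of_ncard_le fun y => ?_
  refine le_trans ?_ ((Polynomial.ncard_agreeing_le ha hk hγ hs hD ht y).trans hL)
  have hfin := (Polynomial.finite_degreeLT (F := F) (k * l)).subset
    fun h (hh : h ∈ {h : Polynomial F | h ∈ Polynomial.degreeLT F (k * l) ∧
      {i : Fin n | ¬ ∀ j : Fin a, h.eval (γ ^ ((i : ℕ) * l + j)) = y i j}.ncard ≤ t}) => hh.1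
  refine le_trans (Set.ncard_le_ncard ?_ (Set.toFinite _))
    (Set.ncard_image_le (f := foldedEval γ n l) hfin)
  rintro c ⟨hc, hct⟩
  rw [foldedRS_eq_image] at hc
  obtain ⟨h, hd, rfl⟩ := hc
  refine ⟨h, ⟨hd, le_trans (le_of_eq ?_) hct⟩, rfl⟩
  congr 1
  ext i
  exact not_congr funext_iff.symm

/-- Without errors, the first `a` symbols of each column determine the codeword as soon as there
are enough of them. -/
theorem foldedRS_listDecodesReading_zero {F : Type} [Field F] [Finite F] {γ : F} {n l k a L : ℕ}
    (ha : a ≤ l) (hγ : Set.InjOn (fun r : ℕ => γ ^ r) (Set.Iio (n * l)))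
    (hka : k * l ≤ n * a) (hL : 0 < L) :
    ListDecodesReading (foldedRS γ n k l) (fun _ => firstSymbols ha) L 0 := by
  refine listDecodesReading_of_ncard_le fun y => ?_
  refine le_trans ?_ hL
  rw [Set.ncard_le_one (Set.toFinite _)]
  rintro c ⟨hc, hc0⟩ c' ⟨hc', hc0'⟩
  rw [foldedRS_eq_image] at hc hc'
  obtain ⟨h, hd, rfl⟩ := hc
  obtain ⟨h', hd', rfl⟩ := hc'
  rw [Nat.le_zero, Set.ncard_eq_zero (Set.toFinite _), Set.eq_empty_iff_forall_notMem] at hc0 hc0'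
  suffices h - h' = 0 by rw [sub_eq_zero.1 this]
  refine Polynomial.eq_zero_of_eval_blocks (w := a) ha hγ (G := Finset.univ) (E := k * l)
    (by simpa using hka) (Submodule.sub_mem _ hd hd') ?_
  intro i _ j hj
  have h1 := congrFun ((not_not.1 (hc0 i)).trans (not_not.1 (hc0' i)).symm) ⟨j, hj⟩
  simp only [foldedEval, firstSymbols, Fin.castLE_mk] at h1
  rw [Polynomial.eval_sub, h1, sub_self]

/-! ### Choice of field and parameters -/

theorem exists_isPrimitiveRoot_zmod (p : ℕ) [Fact p.Prime] :
    ∃ γ : ZMod p, IsPrimitiveRoot γ (p - 1) := by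
  obtain ⟨g, hg⟩ := IsCyclic.exists_generator (α := (ZMod p)ˣ)
  refine ⟨g, ?_⟩
  rw [IsPrimitiveRoot.coe_units_iff, ← ZMod.card_units p,
    ← Nat.card_eq_fintype_card, ← orderOf_eq_card_of_forall_mem_zpowers hg]
  exact IsPrimitiveRoot.orderOf g

theorem IsPrimitiveRoot.injOn_pow_Iio {F : Type*} [Field F] {γ : F} {q m : ℕ}
    (hγ : IsPrimitiveRoot γ (q - 1)) (hm : m < q) :
    Set.InjOn (fun r : ℕ => γ ^ r) (Set.Iio m) := fun i hi j hj h =>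
  hγ.pow_inj (by have := Set.mem_Iio.1 hi; omega) (by have := Set.mem_Iio.1 hj; omega) h

/-- For large `N`, a window length `s` depending only on `R, α, τ` admits an interpolation degree `D`
for decoding `⌈τ N⌉` errors. -/
theorem exists_window_length {R α τ : ℝ} (hR : 0 < R) (hα : 0 < α)
    (hτ0 : 0 ≤ τ) (hτ : τ < 1 - R / α) :
    ∃ s : ℕ, 0 < s ∧ ∀ᶠ N : ℕ in atTop, ∃ D : ℕ,
      N * (⌊α * N⌋₊ + 1 - s) < D + ⌊R * N⌋₊ * N + s * D ∧
      D + ⌊R * N⌋₊ * N ≤ (N - ⌈τ * N⌉₊) * (⌊α * N⌋₊ + 1 - s) := by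
  have hδ : 0 < (1 - τ) * α - R := by
    have : R / α < 1 - τ := by linarith
    rw [div_lt_iff₀ hα] at this
    linarith
  have hτ1 : τ < 1 := by have : 0 < R / α := by positivity
                         linarith
  -- The slack is `δ = (1 - τ) α - R`. Taking `s > 2 α / δ` keeps the interpolation cost `N w / (s +
  -- 1)` below `δ N² / 2`.
  obtain ⟨s, hs⟩ := exists_nat_gt (max 1 (2 * α / ((1 - τ) * α - R)))
  have hs1 : (1 : ℝ) < s := (le_max_left _ _).trans_lt hs
  have hs2 : 2 * α / ((1 - τ) * α - R) < s := (le_max_right _ _).trans_lt hs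
  rw [div_lt_iff₀ hδ] at hs2
  set δ := (1 - τ) * α - R with hδdef
  refine ⟨s, by exact_mod_cast zero_lt_one.trans hs1, ?_⟩
  -- The other half of the slack, `δ N² / 2`, absorbs the linear errors from window length and
  -- rounding.
  have hev : ∀ᶠ N : ℕ in atTop, max (2 * (s + α + 1) / δ) (max ((s : ℝ) / α) 1) < N :=
    tendsto_natCast_atTop_atTop.eventually_gt_atTop _
  filter_upwards [hev] with N hN
  obtain ⟨hN1, hN2, hN3⟩ : 2 * (s + α + 1) / δ < N ∧ (s : ℝ) / α < N ∧ (1 : ℝ) < N := by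
    simpa [max_lt_iff] using hN
  rw [div_lt_iff₀ hδ] at hN1
  rw [div_lt_iff₀ hα] at hN2
  have hsa : s ≤ ⌊α * N⌋₊ := Nat.le_floor (by linarith)
  set a := ⌊α * N⌋₊ with ha
  set w := a + 1 - s with hw
  have hwR : (w : ℝ) = a + 1 - s := by rw [hw, Nat.cast_sub (by omega)]; push_cast; ring
  have ha1 : (a : ℝ) ≤ α * N := Nat.floor_le (by positivity)
  have ha2 : α * N < a + 1 := Nat.lt_floor_add_one _
  have hk : (⌊R * N⌋₊ : ℝ) ≤ R * N := Nat.floor_le (by positivity)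
  set k := ⌊R * N⌋₊
  have ht : (⌈τ * N⌉₊ : ℝ) < τ * N + 1 := Nat.ceil_lt_add_one (by positivity)
  have htN : ⌈τ * N⌉₊ ≤ N := Nat.ceil_le.2 (by nlinarith)
  set t := ⌈τ * N⌉₊
  -- The least `D` with `(s + 1) D > N w`; the unknowns counted by `k * l` are not needed.
  refine ⟨N * w / (s + 1) + 1, ?_, ?_⟩
  · have := Nat.lt_mul_div_succ (N * w) (Nat.succ_pos s)
    simp only [Nat.succ_eq_add_one] at this
    calc N * w < (s + 1) * (N * w / (s + 1) + 1) := this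
      _ = (N * w / (s + 1) + 1) + s * (N * w / (s + 1) + 1) := by ring
      _ ≤ _ := by omega
  · have hD : ((N * w / (s + 1) : ℕ) : ℝ) ≤ N * w / (s + 1) := by
      have := @Nat.cast_div_le ℝ _ _ _ (N * w) (s + 1)
      simpa using this
    have hD2 : (N * w / (s + 1) : ℝ) ≤ δ / 2 * N ^ 2 := by
      rw [div_le_iff₀ (by positivity)]
      have h1 : (w : ℝ) ≤ α * N := by linarith
      have h2 : (N : ℝ) * w ≤ N * (α * N) := by gcongr
      have h3 : α ≤ δ / 2 * (s + 1) := by nlinarith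
      have h4 : α * (N : ℝ) ^ 2 ≤ δ / 2 * (s + 1) * N ^ 2 := by gcongr
      nlinarith
    have hgoal : (((N * w / (s + 1) : ℕ) : ℝ) + 1) + k * N ≤ (N - t) * w := by
      have h1 : ((1 - τ) * N - 1) * w ≤ ((N : ℝ) - t) * w := by
        have : (1 - τ) * (N : ℝ) - 1 ≤ N - t := by linarith
        gcongr
      have h2 : (k : ℝ) * N ≤ R * N * N := by gcongr
      have h3 : α * (N : ℝ) - s ≤ w := by linarith
      have h4 : (1 - τ) * N * (α * (N : ℝ) - s) ≤ (1 - τ) * N * w := by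
        have : 0 ≤ 1 - τ := by linarith
        gcongr
      have h5 : (w : ℝ) ≤ α * N := by linarith
      have h6 : (1 - τ) * (N : ℝ) * s ≤ N * s := by
        have : 0 ≤ τ * (N * s) := by positivity
        nlinarith
      have h7 : 2 * (s + α + 1) * (N : ℝ) ≤ N * δ * N := by gcongr
      have h8 : R * (N : ℝ) * N = (1 - τ) * N * (α * N) - δ * N ^ 2 := by rw [hδdef]; ring
      nlinarith
    rw [← Nat.cast_sub htN] at hgoal
    exact_mod_cast hgoal

/-- `b` is the denominator of a rational `x`, and 1 otherwise, so one choice of lengths covers both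
cases. -/
theorem exists_pos_mul_eq_natCast_of_not_irrational {x : ℝ} (hx : 0 ≤ x) :
    ∃ b : ℕ, 0 < b ∧ (¬ Irrational x → ∀ m : ℕ, ∃ k : ℕ, x * (b * m : ℕ) = k) := by
  by_cases h : Irrational x
  · exact ⟨1, one_pos, fun h' => absurd h h'⟩
  · obtain ⟨q, hq⟩ := not_not.1 h
    refine ⟨q.den, q.den_pos, fun _ m => ⟨q.num.toNat * m, ?_⟩⟩
    have hq0 : 0 ≤ q.num := by
      rw [Rat.num_nonneg]; have : (0 : ℝ) ≤ (q : ℝ) := hq ▸ hx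
      exact_mod_cast this
    have h1 : ((q.num.toNat : ℕ) : ℝ) = q.num := by
      exact_mod_cast Int.toNat_of_nonneg hq0
    have h2 : (q : ℝ) * q.den = q.num := by exact_mod_cast Rat.mul_den_eq_num q
    rw [← hq]
    push_cast
    rw [h1, ← h2]
    ring

/-- Folded Reed–Solomon codes of length and sub-packetization `N` attain the capacity. -/
theorem eventually_foldedRS_listDecodes {R α : ℝ} (hR : 0 < R) (hRα : R ≤ α) (hα : α ≤ 1) {ε : ℝ}
    (hε : 0 < ε) :
    ∃ m : ℕ, ∀ᶠ N : ℕ in atTop, ∃ t : ℕ, t ≤ N ∧ (1 - R / α - ε) * N ≤ t ∧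
      ∀ (F : Type) [Field F] [Finite F] (γ : F), IsPrimitiveRoot γ (Nat.card F - 1) →
        N * N < Nat.card F → Nat.card F ≤ 2 * (N * N) →
        ListDecodesReading (foldedRS γ N ⌊R * N⌋₊ N)
          (fun _ => firstSymbols (floor_mul_le_of_le_one hα N)) (N ^ m) t := by
  have hα0 : 0 < α := hR.trans_le hRα
  -- At `R = α` there is no slack, but the target is `t = 0`: the `N ⌊α N⌋` symbols read just
  -- suffice for unique decoding.
  rcases hRα.eq_or_lt with rfl | hlt
  · refine ⟨0, Eventually.of_forall fun N => ⟨0, Nat.zero_le _, ?_, fun F _ _ γ hγ hF _ => ?_⟩⟩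
    · rw [div_self hR.ne', sub_self, zero_sub, Nat.cast_zero]
      exact mul_nonpos_of_nonpos_of_nonneg (neg_nonpos.2 hε.le) (Nat.cast_nonneg N)
    · exact foldedRS_listDecodesReading_zero _ (hγ.injOn_pow_Iio hF) (Nat.mul_comm _ _).le (by simp)
  · have hlt' : R / α < 1 := (div_lt_one hα0).2 hlt
    obtain ⟨s, hs, hev⟩ := exists_window_length (τ := max 0 (1 - R / α - ε)) hR hα0
      (le_max_left _ _) (max_lt (by linarith) (by linarith))
    -- For `N ≥ 2`, `q ≤ 2 N² ≤ N³`.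
    refine ⟨3 * (s - 1), ?_⟩
    filter_upwards [hev, eventually_ge_atTop 2] with N ⟨D, hD1, hD2⟩ hN
    refine ⟨⌈max 0 (1 - R / α - ε) * N⌉₊, ?_, ?_, fun F _ _ γ hγ hF hF2 => ?_⟩
    · refine Nat.ceil_le.2 (mul_le_of_le_one_left (Nat.cast_nonneg N) (max_le zero_le_one ?_))
      have : 0 < R / α := by positivity
      linarith
    · refine le_trans ?_ (Nat.le_ceil _)
      gcongr
      exact le_max_right _ _
    · refine foldedRS_listDecodesReading _ ?_ (hγ.injOn_pow_Iio hF) hs hD1 hD2 ?_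
      · exact Nat.floor_le_of_le (mul_le_of_le_one_left (Nat.cast_nonneg N) (hRα.trans hα))
      · rw [pow_mul]
        refine Nat.pow_le_pow_left (hF2.trans ?_) _
        calc 2 * (N * N) ≤ N * (N * N) := by gcongr
          _ = N ^ 3 := by ring

theorem mainTheorem4 (R α : ℝ) (hR : 0 < R) (hRα : R ≤ α) (hα : α ≤ 1) :
    alphaListCapacity α R = 1 - R / α ∧
    ∃ (n l : ℕ → ℕ) (F : ℕ → Type) (_ : ∀ j, Field (F j)) (_ : ∀ j, Finite (F j))
      (γ : ∀ j, F j),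
      StrictMono n ∧ StrictMono l ∧ (∀ j, 0 < n j) ∧ (∀ j, 0 < l j) ∧
      (∀ j, n j * l j < Nat.card (F j)) ∧
      (∀ j, IsPrimitiveRoot (γ j) (Nat.card (F j) - 1)) ∧
      (¬ Irrational R → ∀ j, ∃ k : ℕ, R * n j = k) ∧
      (¬ Irrational α → ∀ j, ∃ a : ℕ, α * l j = a) ∧
      ∀ ε : ℝ, 0 < ε → ∃ m : ℕ, ∀ᶠ j in atTop, ∃ t : ℕ,
        (1 - R / α - ε) * n j ≤ t ∧
        ListDecodesReading (foldedRS (γ j) (n j) ⌊R * n j⌋₊ (l j))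
          (fun _ => firstSymbols (floor_mul_le_of_le_one hα (l j))) (n j ^ m) t := by
  have hα0 : 0 < α := hR.trans_le hRα
  -- Bertrand's postulate: the field exceeds `n l = N²` yet stays polynomial in `N`.
  have hp : ∀ N : ℕ, 0 < N → ∃ p, p.Prime ∧ N * N < p ∧ p ≤ 2 * (N * N) := fun N hN =>
    Nat.exists_prime_lt_and_le_two_mul (N * N) (by positivity)
  constructor
  · apply le_antisymm
    · exact ciSup_le fun m => limsup_maxListRadius_div_le hR hRα m
    · refine le_of_forall_pos_sub_le fun ε hε => ?_
      obtain ⟨m, hm⟩ := eventually_foldedRS_listDecodes hR hRα hα hε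
      refine le_trans ?_ (le_ciSup ⟨1 - R / α, ?_⟩ m)
      · refine le_limsup_of_frequently_le (Eventually.frequently ?_)
          (isBoundedUnder_maxListRadius_div α R m)
        filter_upwards [hm, eventually_gt_atTop 0] with N ⟨t, htN, ht, hdec⟩ hN
        obtain ⟨p, hprime, hp1, hp2⟩ := hp N hN
        have := Fact.mk hprime
        obtain ⟨γ, hγ⟩ := exists_isPrimitiveRoot_zmod p
        have hcard : Nat.card (ZMod p) = p := Nat.card_zmod p
        have hdec' := hdec (ZMod p) γ (by rwa [hcard]) (by rwa [hcard]) (by rwa [hcard])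
        have hkN : ⌊R * N⌋₊ ≤ N :=
          Nat.floor_le_of_le (mul_le_of_le_one_left (Nat.cast_nonneg N) (hRα.trans hα))
        have hC := ncard_foldedRS (γ := γ) (k := ⌊R * N⌋₊) hkN (hγ.injOn_pow_Iio hp1)
        have hle : t ≤ maxListRadius α (N ^ m) N ⌊R * N⌋₊ := by
          refine (le_codeListRadius htN ⟨_, _, ?_, hdec'⟩).trans
            (codeListRadius_le_maxListRadius hN hC α _)
          have := Nat.floor_le (a := α * N) (by positivity)
          simp only [Finset.sum_const, Finset.card_univ, Fintype.card_fin, smul_eq_mul]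
          push_cast
          nlinarith [(Nat.cast_nonneg N : (0 : ℝ) ≤ N)]
        rw [le_div_iff₀ (by exact_mod_cast hN)]
        exact ht.trans (by exact_mod_cast hle)
      · rintro _ ⟨m, rfl⟩
        exact limsup_maxListRadius_div_le hR hRα m
  · obtain ⟨b, hb, hbR⟩ := exists_pos_mul_eq_natCast_of_not_irrational hR.le
    obtain ⟨b', hb', hbα⟩ := exists_pos_mul_eq_natCast_of_not_irrational hα0.le
    -- Common multiples of `b` and `b'` clear the denominators of `R` and `α` together.
    let N : ℕ → ℕ := fun j => b * b' * (j + 1)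
    have hbb : 0 < b * b' := Nat.mul_pos hb hb'
    have hNpos : ∀ j, 0 < N j := fun j => Nat.mul_pos hbb (Nat.succ_pos j)
    have hNmono : StrictMono N := fun i j hij =>
      Nat.mul_lt_mul_of_pos_left (Nat.succ_lt_succ hij) hbb
    choose p hprime hp1 hp2 using fun j => hp (N j) (hNpos j)
    have : ∀ j, Fact (p j).Prime := fun j => ⟨hprime j⟩
    choose γ hγ using fun j => exists_isPrimitiveRoot_zmod (p j)
    have hcard : ∀ j, Nat.card (ZMod (p j)) = p j := fun j => Nat.card_zmod _
    refine ⟨N, N, fun j => ZMod (p j), fun j => inferInstance, fun j => inferInstance, γ,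
      hNmono, hNmono, hNpos, hNpos, fun j => by rw [hcard]; exact hp1 j,
      fun j => by rw [hcard]; exact hγ j, fun h j => ?_, fun h j => ?_, fun ε hε => ?_⟩
    · have := hbR h (b' * (j + 1))
      rwa [← mul_assoc] at this
    · have := hbα h (b * (j + 1))
      rwa [← mul_assoc, mul_comm b' b] at this
    · obtain ⟨m, hm⟩ := eventually_foldedRS_listDecodes hR hRα hα hε
      refine ⟨m, ?_⟩
      filter_upwards [hNmono.tendsto_atTop.eventually hm] with j ⟨t, _, ht, hdec⟩
      exact ⟨t, ht, hdec (ZMod (p j)) (γ j) (by rw [hcard]; exact hγ j)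
        (by rw [hcard]; exact hp1 j) (by rw [hcard]; exact hp2 j)⟩
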